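/- Let $(\mathcal X,\|\cdot\|)$ and $(\mathcal Z,\|\cdot\|_{\mathcal Z})$ be separable real Banach spaces, let $S\colon\mathcal X\times\mathcal Z\to\mathcal X$ be locally Lipschitz, and let $\xi_0,\xi_1,\dots$ be i.i.d. $\mathcal Z$-valued random variables whose common law $\ell$ has compact support $\mathcal E$. Let $P_n(x,\cdot)$ be the law of $x_n$, where $x_{n+1}=S(x_n,\xi_n)$ and $x_0=x$. Let $0<q'<q<1$, and assume the following. (C1) $\mathcal Z=\mathcal Z_1\oplus\mathcal Z_2$ is a topological direct sum of subspaces (the projections are continuous) with $\mathcal Z_1$ finite dimensional, and $\ell=\ell_1\otimes\ell_2$, where $\ell_i$ is the push-forward of $\ell$ under the projection of $\mathcal Z$ onto $\mathcal Z_i$. Moreover $\ell_1$ has a $C^1$ density with respect to Lebesgue measure on $\mathcal Z_1$. (C2) There are a compact set $\mathcal Y\subset\mathcal X$ with $S(\mathcal Y\times\mathcal E)\subset\mathcal Y$ and a constant $d>0$ such that, for all $\vec y=(y_1,y_2)\in\mathcal Y\times\mathcal Y$ with $\|y_1-y_2\|\le d$, there is a locally Lipschitz and continuously differentiable map $\Phi^{\vec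 y}\colon\mathcal Z\to\mathcal Z_1$ with $$\|S(y_1,\zeta)-S(y_2,\zeta+\Phi^{\vec y}(\zeta))\|\le q'\|y_1-y_2\|\quad\text{for }\ell\text{-a.e. }\zeta\in\mathcal Z.$$ (C3) There is a constant $C>0$, independent of $\vec y$, such that for all these $\vec y$ and all $\zeta\in\mathcal Z$ $$\|\Phi^{\vec y}(\zeta)\|_{\mathcal Z}\le C\|y_1-y_2\|\,\|\zeta\|_{\mathcal Z}\quad\text{and}\quad \operatorname{Lip}(\Phi^{\vec y})\le C\|y_1-y_2\|.$$ Then the coupling hypothesis (C) holds on $\mathcal Y$, that is, the following holds with some rate in $[0,1)$ in place of $q$. More precisely, it holds with the given $q$: there exist a constant $C>0$, a probability space $(\Omega,\mathcal F,\mathbb P)$ and measurable maps $\mathcal R,\mathcal R'\colon\mathcal Y\times\mathcal Y\times\Omega\to\mathcal X$ such that, for all $y_1,y_2\in\mathcal Y$, the random variables $\mathcal R(y_1,y_2)$ and $\mathcal R'(y_1,y_2)$ have laws $P_1(y_1,\cdot)$ and $P_1(y_2,\cdot)$ respectively, and $$\mathbb P\big(\|\mathcal R(y_1,y_2)-\mathcal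 R'(y_1,y_2)\|>q\|y_1-y_2\|\big)\le C\|y_1-y_2\|.$$ -/

import Mathlib

open MeasureTheory ProbabilityTheory

noncomputable section

/-- The trajectory `x₀ = x`, `xₙ₊₁ = S (xₙ, ζₙ)` of the dynamical system driven by `ζ`. -/
def rdsOrbit {X Z : Type*} (S : X × Z → X) (x : X) (ζ : ℕ → Z) : ℕ → X
  | 0 => x
  | n + 1 => S (rdsOrbit S x ζ n, ζ n)

/-- The Markov transition function `Pₙ(x, ·)`: the law of `xₙ` when the system starts at `x` and is
driven by the random sequence `ξ` defined on the probability space `(Ω₀, P₀)`. -/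
def rdsTransition {X Z Ω₀ : Type*} [MeasurableSpace X] [MeasurableSpace Ω₀]
    (S : X × Z → X) (ξ : ℕ → Ω₀ → Z) (P₀ : Measure Ω₀) (n : ℕ) (x : X) : Measure X :=
  P₀.map (fun ω => rdsOrbit S x (fun k => ξ k ω) n)

/-- `ξ₀, ξ₁, …` are independent random variables with common law `ℓ`. -/
structure IsIIDWithLaw {Z Ω₀ : Type*} [MeasurableSpace Z] [MeasurableSpace Ω₀]
    (ξ : ℕ → Ω₀ → Z) (P₀ : Measure Ω₀) (ℓ : Measure Z) : Prop where
  measurable : ∀ n, Measurable (ξ n)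
  indep : iIndepFun ξ P₀
  law : ∀ n, P₀.map (ξ n) = ℓ

/-- `Y` is invariant: `S (Y × E) ⊆ Y`, where `E` is the support of the noise law `ℓ`. -/
def IsInvariantSet {X Z : Type*} [TopologicalSpace Z] [MeasurableSpace Z]
    (S : X × Z → X) (ℓ : Measure Z) (Y : Set X) : Prop :=
  ∀ y ∈ Y, ∀ ζ ∈ ℓ.support, S (y, ζ) ∈ Y

/-- The pair `(f, g)` of random variables on `(Ω, P)` is a coupling of `μ` and `ν`. -/
structure IsCoupling {Ω X : Type*} [MeasurableSpace Ω] [MeasurableSpace X]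
    (P : Measure Ω) (f g : Ω → X) (μ ν : Measure X) : Prop where
  measurable_left : Measurable f
  measurable_right : Measurable g
  map_left : P.map f = μ
  map_right : P.map g = ν

/-- The coupling condition on `Y` with rate `q`, for a family `Q y` of probability measures: there
are a constant `C > 0`, one probability space `(Ω, P)` and jointly measurable maps
`R, R' : Y × Y × Ω → X` such that `(R (y₁, y₂, ·), R' (y₁, y₂, ·))` is a coupling of `Q y₁` and
`Q y₂` whose components are more than `q ‖y₁ - y₂‖` apart with probability at most
`C ‖y₁ - y₂‖`. -/
def CouplingWithRate {X : Type*} [NormedAddCommGroup X] [MeasurableSpace X]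
    (Q : X → Measure X) (Y : Set X) (q : ℝ) : Prop :=
  ∃ C : ℝ, 0 < C ∧
    ∃ (Ω : Type) (_ : MeasurableSpace Ω) (P : Measure Ω) (R R' : Y × Y × Ω → X),
      IsProbabilityMeasure P ∧ Measurable R ∧ Measurable R' ∧
      ∀ y₁ y₂ : Y,
        IsCoupling P (fun ω => R (y₁, y₂, ω)) (fun ω => R' (y₁, y₂, ω)) (Q y₁) (Q y₂) ∧
        P.real {ω | q * ‖(y₁ : X) - (y₂ : X)‖ < ‖R (y₁, y₂, ω) - R' (y₁, y₂, ω)‖} ≤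
          C * ‖(y₁ : X) - (y₂ : X)‖

/-- Hypothesis (C): the coupling condition on `Y` holds with some rate `q ∈ [0, 1)`. -/
def HypothesisC {X : Type*} [NormedAddCommGroup X] [MeasurableSpace X]
    (Q : X → Measure X) (Y : Set X) : Prop :=
  ∃ q : ℝ, 0 ≤ q ∧ q < 1 ∧ CouplingWithRate Q Y q

section Conditions

variable {X Z : Type*} [NormedAddCommGroup X] [NormedAddCommGroup Z] [NormedSpace ℝ Z]
  [MeasurableSpace Z]

/-- Condition (C1) for the decomposition `Z = Z₁ ⊕ Z₂` (topological direct sum, `Z₁` of finite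
dimension): `ℓ = ℓ₁ ⊗ ℓ₂`, where `ℓᵢ` is the image of `ℓ` under the projection onto `Zᵢ`, and `ℓ₁`
has a `C¹` density with respect to Lebesgue measure on `Z₁`. The product measure on `Z₁ × Z₂` is
regarded as a measure on `Z` through `(z₁, z₂) ↦ z₁ + z₂`. -/
structure ConditionC1 [BorelSpace Z] (ℓ : Measure Z) (Z₁ Z₂ : Submodule ℝ Z)
    [FiniteDimensional ℝ Z₁] (h : Z₁.IsTopCompl Z₂) : Prop where
  product : ℓ = ((ℓ.map (Z₁.projectionOntoL Z₂ h)).prod (ℓ.map (Z₂.projectionOntoL Z₁ h.symm))).map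
    (fun z : Z₁ × Z₂ => (z.1 : Z) + (z.2 : Z))
  density : ∃ ρ : Z₁ → ℝ, ContDiff ℝ 1 ρ ∧ (∀ z, 0 ≤ ρ z) ∧
    ℓ.map (Z₁.projectionOntoL Z₂ h) =
      (Measure.addHaar : Measure Z₁).withDensity (fun z => ENNReal.ofReal (ρ z))

/-- Condition (C2) for the set `Y`, the constants `d`, `q'` and the family `Φ y₁ y₂` of maps
`Z → Z₁`, of which only the members with `y₁, y₂ ∈ Y` and `‖y₁ - y₂‖ ≤ d` matter. -/
structure ConditionC2 (S : X × Z → X) (ℓ : Measure Z) (Z₁ : Submodule ℝ Z)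
    (Y : Set X) (d q' : ℝ) (Φ : X → X → Z → Z₁) : Prop where
  compact : IsCompact Y
  invariant : IsInvariantSet S ℓ Y
  pos : 0 < d
  lipschitz : ∀ y₁ ∈ Y, ∀ y₂ ∈ Y, ‖y₁ - y₂‖ ≤ d → LocallyLipschitz (Φ y₁ y₂)
  contDiff : ∀ y₁ ∈ Y, ∀ y₂ ∈ Y, ‖y₁ - y₂‖ ≤ d → ContDiff ℝ 1 (Φ y₁ y₂)
  squeezing : ∀ y₁ ∈ Y, ∀ y₂ ∈ Y, ‖y₁ - y₂‖ ≤ d →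
    ∀ᵐ ζ ∂ℓ, ‖S (y₁, ζ) - S (y₂, ζ + (Φ y₁ y₂ ζ : Z))‖ ≤ q' * ‖y₁ - y₂‖

/-- Condition (C3): `‖Φ ζ‖ ≤ C ‖y₁ - y₂‖ ‖ζ‖` for all `ζ`, and `Lip Φ ≤ C ‖y₁ - y₂‖`, where
`Φ = Φ y₁ y₂` and the constant `C` does not depend on `y₁, y₂`. -/
def ConditionC3 (Z₁ : Submodule ℝ Z) (Y : Set X) (d : ℝ) (Φ : X → X → Z → Z₁) : Prop :=
  ∃ C : ℝ, 0 < C ∧ ∀ y₁ ∈ Y, ∀ y₂ ∈ Y, ‖y₁ - y₂‖ ≤ d →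
    (∀ ζ : Z, ‖Φ y₁ y₂ ζ‖ ≤ C * ‖y₁ - y₂‖ * ‖ζ‖) ∧
    (∀ ζ ζ' : Z, ‖Φ y₁ y₂ ζ - Φ y₁ y₂ ζ'‖ ≤ C * ‖y₁ - y₂‖ * ‖ζ - ζ'‖)

end Conditions

end

/-!
For a pair `y₁, y₂ ∈ Y` at small distance `r`, the noise `ζ` for `y₁` should be matched with the noise
`Ψ ζ = ζ + Φ ζ` for `y₂`, because of the squeezing property. The law of `Ψ ζ` is not `ℓ`, but it
is within `O(r)` of it in total variation: in the coordinates `Z₁ × Z₂`, the map `Ψ` is a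
shear along the finite-dimensional factor by a map that is `O(r)`-Lipschitz and of size `O(r)` on
the support. The push-forward of Haar measure is therefore at most `(1 - O(r))⁻ⁿ` times Haar measure
(`addHaar_preimage_le_of_antilipschitz`, `smul_map_shear_le`), and `ρ` changes by `O(r)` along `Ψ`,
as a `C¹` function with compact support is Lipschitz. Hence `ℓ` has a part of mass
`1 - O(r)` whose image under `Ψ` is again below `ℓ` (`exists_le_and_map_shear_le`). Moving this part
along `Ψ` and coupling the remainders independently gives a self-coupling of `ℓ`
(`exists_coupling_of_le_of_map_le`, `exists_noise_coupling`).

These couplings need not depend measurably on `(y₁, y₂)`, as `Φ` is not assumed to. Here the gap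
between `q'` and `q` helps: by uniform continuity of `S` near `{y} × supp ℓ`, the noise coupling
chosen at an off-diagonal pair still works, with rate `q`, at all nearby pairs
(`eventually_measureReal_lt_norm_sub_le`). By the Lindelöf property countably many couplings serve
all off-diagonal pairs, and on the diagonal both components use the same noise. The resulting
Markov kernel from `Y × Y` takes countably many values, and is realised by random variables on the
unit interval (`exists_unitInterval_map_eq_of_iUnion_eq_univ`).
-/

open scoped ENNReal NNReal Topology

/-! ### Perturbations of the identity and Haar measure -/

/-- Haar measure is a multiple of the Hausdorff measure of dimension `finrank ℝ E`, and an
antilipschitz map cannot expand preimages by more than the power of its constant. This bound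
replaces a change of variables with a Jacobian. -/
theorem addHaar_preimage_le_of_antilipschitz {E : Type*} [NormedAddCommGroup E] [NormedSpace ℝ E]
    [FiniteDimensional ℝ E] [MeasurableSpace E] [BorelSpace E] (μ : Measure E)
    [μ.IsAddHaarMeasure] {f : E → E} {K : ℝ≥0} (hf : AntilipschitzWith K f) (s : Set E) :
    μ (f ⁻¹' s) ≤ (K : ℝ≥0∞) ^ Module.finrank ℝ E * μ s := by
  have h := hf.hausdorffMeasure_preimage_le (d := (Module.finrank ℝ E : ℝ)) (by positivity) s
  rw [ENNReal.rpow_natCast] at h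
  rw [Measure.isAddLeftInvariant_eq_smul μ (Measure.hausdorffMeasure (Module.finrank ℝ E))]
  simp only [Measure.smul_apply, ENNReal.smul_def, smul_eq_mul]
  rw [mul_left_comm]
  gcongr

theorem antilipschitz_id_add {E : Type*} [NormedAddCommGroup E] {φ : E → E} {η : ℝ} (hη : η < 1)
    (hφ : ∀ x y, ‖φ x - φ y‖ ≤ η * ‖x - y‖) :
    AntilipschitzWith (Real.toNNReal (1 - η)⁻¹) (fun x => x + φ x) := by
  refine AntilipschitzWith.of_le_mul_dist fun x y => ?_
  have h1 : 0 < 1 - η := by linarith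
  rw [Real.coe_toNNReal _ (by positivity), dist_eq_norm, dist_eq_norm, inv_mul_eq_div,
    le_div_iff₀ h1]
  have h2 : x - y = (x + φ x - (y + φ y)) - (φ x - φ y) := by abel
  have h3 : ‖x - y‖ ≤ ‖x + φ x - (y + φ y)‖ + ‖φ x - φ y‖ := by
    conv_lhs => rw [h2]
    exact norm_sub_le _ _
  linarith [hφ x y]

section Shear

variable {E T : Type*} [NormedAddCommGroup E] [NormedSpace ℝ E] [FiniteDimensional ℝ E]
  [MeasurableSpace E] [BorelSpace E] [MeasurableSpace T]

/-- If every `φ (·, t)` is `η`-Lipschitz, the shear `(x, t) ↦ (x + φ (x, t), t)` is antilipschitz on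
each slice, so that the push-forward of `μ ⊗ κ` is at most `(1 - η)⁻ⁿ (μ ⊗ κ)`, `n = finrank ℝ E`. -/
theorem smul_map_shear_le (μ : Measure E) [μ.IsAddHaarMeasure] (κ : Measure T)
    [SFinite κ] {φ : E × T → E} (hφ : Measurable φ) {η : ℝ} (hη : η < 1)
    (hlip : ∀ t x y, ‖φ (x, t) - φ (y, t)‖ ≤ η * ‖x - y‖) :
    ENNReal.ofReal ((1 - η) ^ Module.finrank ℝ E) •
      (μ.prod κ).map (fun p => (p.1 + φ p, p.2)) ≤ μ.prod κ := by
  have h1 : 0 < 1 - η := by linarith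
  have hΨ : Measurable (fun p : E × T => (p.1 + φ p, p.2)) := by fun_prop
  refine Measure.le_iff.2 fun s hs => ?_
  rw [Measure.smul_apply, Measure.map_apply hΨ hs, Measure.prod_apply_symm (hΨ hs),
    Measure.prod_apply_symm hs, smul_eq_mul, ← lintegral_const_mul' _ _ ENNReal.ofReal_ne_top]
  refine lintegral_mono fun t => ?_
  have h := addHaar_preimage_le_of_antilipschitz μ (antilipschitz_id_add hη (hlip t))
    ((fun x => (x, t)) ⁻¹' s)
  refine (mul_le_mul_right h _).trans ?_
  have hinv : ENNReal.ofReal (1 - η) * ((1 - η)⁻¹.toNNReal : ℝ≥0∞) = 1 := by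
    change ENNReal.ofReal (1 - η) * ENNReal.ofReal (1 - η)⁻¹ = 1
    rw [← ENNReal.ofReal_mul h1.le, mul_inv_cancel₀ h1.ne', ENNReal.ofReal_one]
  rw [← mul_assoc, ENNReal.ofReal_pow h1.le, ← mul_pow, hinv, one_pow, one_mul]

/-- A part of the law `ρ μ ⊗ κ` that the shear `Ψ : (x, t) ↦ (x + φ (x, t), t)` carries below
the same law, and whose mass is close to `1`. It has density
`(1 - η)ⁿ min (ρ x) (ρ (x + φ (x, t)))` with respect to `μ ⊗ κ`: the second term of the minimum
controls the image under `Ψ`, and the Lipschitz bound on `ρ` controls the mass lost. -/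
theorem exists_le_and_map_shear_le (μ : Measure E) [μ.IsAddHaarMeasure] (κ : Measure T)
    [IsProbabilityMeasure κ] {ρ : E → ℝ} {L : ℝ≥0} (hρ : LipschitzWith L ρ)
    {K : Set E} (hK : IsCompact K) (hρK : ∀ x ∉ K, ρ x = 0)
    [IsProbabilityMeasure (μ.withDensity fun x => ENNReal.ofReal (ρ x))]
    {φ : E × T → E} (hφ : Measurable φ) {η δ : ℝ} (hη0 : 0 ≤ η) (hη : η < 1)
    (hlip : ∀ t x y, ‖φ (x, t) - φ (y, t)‖ ≤ η * ‖x - y‖)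
    (hδ : ∀ᵐ t ∂κ, ∀ x ∈ K, ‖φ (x, t)‖ ≤ δ) (hδ0 : 0 ≤ δ) :
    ∃ a : Measure (E × T),
      a ≤ (μ.withDensity fun x => ENNReal.ofReal (ρ x)).prod κ ∧
      a.map (fun p => (p.1 + φ p, p.2)) ≤
        (μ.withDensity fun x => ENNReal.ofReal (ρ x)).prod κ ∧
      1 - (Module.finrank ℝ E * η + L * δ * μ.real K) ≤ a.real Set.univ := by
  set n := Module.finrank ℝ E
  set Ψ : E × T → E × T := fun p => (p.1 + φ p, p.2) with hΨdef
  set c : ℝ≥0∞ := ENNReal.ofReal ((1 - η) ^ n) with hc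
  have h1 : 0 < 1 - η := by linarith
  have hΨ : Measurable Ψ := by fun_prop
  have hρm' : Measurable ρ := hρ.continuous.measurable
  have hρm : Measurable (fun x => ENNReal.ofReal (ρ x)) := hρm'.ennreal_ofReal
  have hprod : (μ.withDensity fun x => ENNReal.ofReal (ρ x)).prod κ =
      (μ.prod κ).withDensity fun p => ENNReal.ofReal (ρ p.1) := prod_withDensity_left hρm
  set g : E × T → ℝ≥0∞ := fun p => min (ENNReal.ofReal (ρ p.1)) (ENNReal.ofReal (ρ (Ψ p).1))
  have hg : Measurable g := (hρm.comp measurable_fst).min (hρm.comp (measurable_fst.comp hΨ))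
  have hc1 : c ≤ 1 := ENNReal.ofReal_le_one.2 (pow_le_one₀ h1.le (by linarith))
  have htot : ∫⁻ p, ENNReal.ofReal (ρ p.1) ∂(μ.prod κ) = 1 := by
    have : ((μ.withDensity fun x => ENNReal.ofReal (ρ x)).prod κ) Set.univ = 1 := measure_univ
    rwa [hprod, withDensity_apply _ MeasurableSet.univ, Measure.restrict_univ] at this
  have hgtop : ∫⁻ p, g p ∂(μ.prod κ) ≤ 1 := by
    rw [← htot]
    exact lintegral_mono fun p => min_le_left _ _
  refine ⟨(μ.prod κ).withDensity fun p => c * g p, ?_, ?_, ?_⟩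
  · rw [hprod]
    refine withDensity_mono (Filter.Eventually.of_forall fun p => ?_)
    calc c * g p ≤ 1 * ENNReal.ofReal (ρ p.1) := mul_le_mul' hc1 (min_le_left _ _)
      _ = _ := one_mul _
  · rw [hprod]
    refine Measure.le_iff.2 fun s hs => ?_
    rw [Measure.map_apply hΨ hs, withDensity_apply _ (hΨ hs), withDensity_apply _ hs]
    calc ∫⁻ p in Ψ ⁻¹' s, c * g p ∂(μ.prod κ)
        ≤ ∫⁻ p in Ψ ⁻¹' s, c * ENNReal.ofReal (ρ (Ψ p).1) ∂(μ.prod κ) :=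
          lintegral_mono fun p => mul_le_mul_right (min_le_right _ _) _
      _ = c * ∫⁻ p in s, ENNReal.ofReal (ρ p.1) ∂((μ.prod κ).map Ψ) := by
          rw [setLIntegral_map hs (by fun_prop) hΨ, lintegral_const_mul' _ _ ENNReal.ofReal_ne_top]
      _ = ∫⁻ p in s, ENNReal.ofReal (ρ p.1) ∂(c • (μ.prod κ).map Ψ) := by
          rw [Measure.restrict_smul, lintegral_smul_measure, smul_eq_mul]
      _ ≤ _ := lintegral_mono'
          (Measure.restrict_mono le_rfl (smul_map_shear_le μ κ hφ hη hlip)) le_rfl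
  · have hkey : 1 ≤ ∫⁻ p, g p ∂(μ.prod κ) + ENNReal.ofReal (L * δ) * μ K := by
      have hKm := hK.measurableSet
      have hae : ∀ᵐ p ∂(μ.prod κ), ∀ x ∈ K, ‖φ (x, p.2)‖ ≤ δ :=
        Measure.quasiMeasurePreserving_snd.ae hδ
      calc (1 : ℝ≥0∞) = ∫⁻ p, ENNReal.ofReal (ρ p.1) ∂(μ.prod κ) := htot.symm
        _ ≤ ∫⁻ p, (g p + (K ×ˢ Set.univ).indicator (fun _ => ENNReal.ofReal (L * δ)) p)
              ∂(μ.prod κ) := by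
            refine lintegral_mono_ae (hae.mono fun p hp => ?_)
            by_cases hpK : p.1 ∈ K
            · have hmem : p ∈ K ×ˢ (Set.univ : Set T) := ⟨hpK, trivial⟩
              rw [Set.indicator_of_mem hmem]
              have h2 : |ρ p.1 - ρ (Ψ p).1| ≤ L * δ := by
                have := hρ.dist_le_mul p.1 (Ψ p).1
                rw [Real.dist_eq, dist_eq_norm] at this
                refine this.trans (mul_le_mul_of_nonneg_left ?_ L.coe_nonneg)
                have h3 : p.1 - (Ψ p).1 = - φ (p.1, p.2) := by simp [hΨdef]
                rw [h3, norm_neg]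
                exact hp _ hpK
              have h4 : ρ p.1 ≤ min (ρ p.1) (ρ (Ψ p).1) + L * δ := by
                rcases min_choice (ρ p.1) (ρ (Ψ p).1) with h | h <;> rw [h]
                · have : 0 ≤ L * δ := by positivity
                  linarith
                · linarith [(abs_le.1 h2).2]
              calc ENNReal.ofReal (ρ p.1) ≤ ENNReal.ofReal (min (ρ p.1) (ρ (Ψ p).1) + L * δ) :=
                    ENNReal.ofReal_le_ofReal h4
                _ ≤ _ := ENNReal.ofReal_add_le
                _ = _ := by rw [ENNReal.ofReal_min]
            · simp [hρK _ hpK]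
        _ = _ := by
            rw [lintegral_add_left hg, lintegral_indicator_const (hKm.prod MeasurableSet.univ),
              Measure.prod_prod, measure_univ, mul_one]
    set m := (∫⁻ p, g p ∂(μ.prod κ)).toReal with hm
    have hm1 : m ≤ 1 := ENNReal.toReal_le_of_le_ofReal zero_le_one (by simpa using hgtop)
    have hm0 : 0 ≤ m := ENNReal.toReal_nonneg
    have hKtop : μ K ≠ ∞ := hK.measure_lt_top.ne
    have hmge : 1 ≤ m + L * δ * μ.real K := by
      have := ENNReal.toReal_mono (ENNReal.add_ne_top.2
        ⟨(hgtop.trans_lt ENNReal.one_lt_top).ne,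
          ENNReal.mul_ne_top ENNReal.ofReal_ne_top hKtop⟩) hkey
      rwa [ENNReal.toReal_one, ENNReal.toReal_add (hgtop.trans_lt ENNReal.one_lt_top).ne
        (ENNReal.mul_ne_top ENNReal.ofReal_ne_top hKtop), ENNReal.toReal_mul,
        ENNReal.toReal_ofReal (by positivity)] at this
    have hmass : ((μ.prod κ).withDensity fun p => c * g p).real Set.univ = (1 - η) ^ n * m := by
      rw [Measure.real, withDensity_apply _ MeasurableSet.univ, Measure.restrict_univ,
        lintegral_const_mul' _ _ ENNReal.ofReal_ne_top, ENNReal.toReal_mul,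
        ENNReal.toReal_ofReal (by positivity)]
    rw [hmass]
    -- Bernoulli's inequality
    have hbern : 1 - n * η ≤ (1 - η) ^ n := by
      have := one_add_mul_le_pow (a := -η) (by linarith) n
      rw [← sub_eq_add_neg] at this
      linarith
    have hnη : 0 ≤ n * η := by positivity
    nlinarith

end Shear

/-! ### Constructions of couplings -/

/-- If `a ≤ μ` and `Ψ_* a ≤ μ`, then `μ` has a self-coupling whose second component is the image
of the first under `Ψ` except with probability `1 - a univ`: the mass of `a` moves along `Ψ`, and
the two remainders are coupled independently. -/
theorem exists_coupling_of_le_of_map_le {T : Type*} [MeasurableSpace T] (μ a : Measure T)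
    [IsProbabilityMeasure μ] {Ψ : T → T} (hΨ : Measurable Ψ) (ha : a ≤ μ) (haΨ : a.map Ψ ≤ μ) :
    ∃ π : Measure (T × T), π.map Prod.fst = μ ∧ π.map Prod.snd = μ ∧
      ∀ s : Set (T × T), MeasurableSet s → (∀ᵐ x ∂μ, (x, Ψ x) ∉ s) →
        π.real s ≤ 1 - a.real Set.univ := by
  have : IsFiniteMeasure a := ⟨(ha _).trans_lt (measure_lt_top _ _)⟩
  have hb := Measure.sub_add_cancel_of_le ha
  have hb' := Measure.sub_add_cancel_of_le haΨ
  set b := μ - a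
  set b' := μ - a.map Ψ
  have : IsFiniteMeasure b := ⟨by
    have : b Set.univ ≤ μ Set.univ := by rw [← hb]; simp
    exact this.trans_lt (measure_lt_top _ _)⟩
  have : IsFiniteMeasure b' := ⟨by
    have : b' Set.univ ≤ μ Set.univ := by rw [← hb']; simp
    exact this.trans_lt (measure_lt_top _ _)⟩
  have hbu : b Set.univ + a Set.univ = 1 := by
    rw [← Measure.add_apply, hb, measure_univ]
  have hbu' : b' Set.univ + a Set.univ = 1 := by
    have : a Set.univ = a.map Ψ Set.univ := by rw [Measure.map_apply hΨ .univ, Set.preimage_univ]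
    rw [this, ← Measure.add_apply, hb', measure_univ]
  have heq : b' Set.univ = b Set.univ :=
    (ENNReal.add_left_inj (measure_ne_top a _)).1 (hbu'.trans hbu.symm)
  have hm : Measurable fun x => (x, Ψ x) := by fun_prop
  -- The remainders `b` and `b'` have the same mass, which may vanish: then they vanish themselves.
  have hself : (b Set.univ)⁻¹ • b Set.univ • b = b := by
    by_cases h0 : b Set.univ = 0
    · rw [Measure.measure_univ_eq_zero.1 h0]; simp
    · rw [smul_smul, ENNReal.inv_mul_cancel h0 (measure_ne_top _ _), one_smul]
  have hself' : (b Set.univ)⁻¹ • b Set.univ • b' = b' := by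
    by_cases h0 : b Set.univ = 0
    · rw [Measure.measure_univ_eq_zero.1 (heq.trans h0)]; simp
    · rw [smul_smul, ENNReal.inv_mul_cancel h0 (measure_ne_top _ _), one_smul]
  refine ⟨a.map (fun x => (x, Ψ x)) + (b Set.univ)⁻¹ • b.prod b', ?_, ?_, ?_⟩
  · rw [Measure.map_add _ _ measurable_fst, Measure.map_smul, Measure.map_fst_prod, heq, hself,
      Measure.map_map measurable_fst hm]
    have : (Prod.fst ∘ fun x => (x, Ψ x)) = id := rfl
    rw [this, Measure.map_id, add_comm, hb]
  · rw [Measure.map_add _ _ measurable_snd, Measure.map_smul, Measure.map_snd_prod, hself',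
      Measure.map_map measurable_snd hm]
    have : (Prod.snd ∘ fun x => (x, Ψ x)) = Ψ := rfl
    rw [this, add_comm, hb']
  · intro s hs hnull
    have h0 : a.map (fun x => (x, Ψ x)) s = 0 := by
      rw [Measure.map_apply hm hs]
      have h2 : ∀ᵐ x ∂a, (x, Ψ x) ∉ s := ae_mono ha hnull
      exact measure_eq_zero_iff_ae_notMem.2 h2
    have h1 : (a.map (fun x => (x, Ψ x)) + (b Set.univ)⁻¹ • b.prod b') s ≤ b Set.univ := by
      rw [Measure.add_apply, h0, zero_add, Measure.smul_apply, smul_eq_mul]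
      calc (b Set.univ)⁻¹ * b.prod b' s ≤ (b Set.univ)⁻¹ * b.prod b' Set.univ := by
            gcongr; exact Set.subset_univ _
        _ = ((b Set.univ)⁻¹ * b Set.univ) * b Set.univ := by
            rw [← Set.univ_prod_univ, Measure.prod_prod, heq, mul_assoc]
        _ ≤ 1 * b Set.univ := by gcongr; exact ENNReal.inv_mul_le_one _
        _ = _ := one_mul _
    have h2 := ENNReal.toReal_mono (measure_ne_top b _) h1
    have h3 : b.real Set.univ + a.real Set.univ = 1 := by
      rw [Measure.real, Measure.real, ← ENNReal.toReal_add (measure_ne_top _ _)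
        (measure_ne_top _ _), hbu, ENNReal.toReal_one]
    change _ ≤ b.real Set.univ at h2
    change Measure.real _ s ≤ _ at h2
    linarith

/-- A countable measurable cover with a probability measure attached to each member yields a
jointly measurable family of random variables on the unit interval, the law at each point being the
measure attached to some member containing that point. -/
theorem exists_unitInterval_map_eq_of_iUnion_eq_univ {T W : Type*} [MeasurableSpace T]
    [MeasurableSpace W] [StandardBorelSpace W] [Nonempty W] {ι : Type*} [Countable ι]
    [Nonempty ι] {U : ι → Set T} (hU : ∀ i, MeasurableSet (U i)) (hcov : ⋃ i, U i = Set.univ)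
    (ν : ι → Measure W) [∀ i, IsProbabilityMeasure (ν i)] :
    ∃ F : T × unitInterval → W, Measurable F ∧
      ∀ t, ∃ i, t ∈ U i ∧ (volume : Measure unitInterval).map (fun ω => F (t, ω)) = ν i := by
  classical
  obtain ⟨e, he⟩ := exists_surjective_nat ι
  have hex : ∀ t, ∃ n, t ∈ U (e n) := fun t => by
    obtain ⟨i, hi⟩ := Set.mem_iUnion.1 (hcov.symm ▸ Set.mem_univ t : t ∈ ⋃ i, U i)
    obtain ⟨n, rfl⟩ := he i
    exact ⟨n, hi⟩
  let N : T → ℕ := fun t => Nat.find (hex t)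
  have hN : Measurable N := measurable_find hex fun n => hU (e n)
  let κ : Kernel T W := ⟨fun t => ν (e (N t)),
    (measurable_of_countable fun n => ν (e n)).comp hN⟩
  have : IsMarkovKernel κ := ⟨fun t => inferInstanceAs (IsProbabilityMeasure (ν (e (N t))))⟩
  obtain ⟨f, hf, hfκ⟩ := κ.exists_measurable_map_eq_unitInterval
  exact ⟨fun p => f p.1 p.2, hf, fun t => ⟨e (N t), Nat.find_spec (hex t), hfκ t⟩⟩

/-! ### Couplings of the noise -/

theorem eq_zero_of_withDensity_compl_eq_zero {E : Type*} [TopologicalSpace E] [MeasurableSpace E]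
    [OpensMeasurableSpace E] (μ : Measure E) [μ.IsOpenPosMeasure] {ρ : E → ℝ}
    (hρ : Continuous ρ) (hρ0 : ∀ x, 0 ≤ ρ x) {K : Set E} (hK : IsClosed K)
    (h : (μ.withDensity fun x => ENNReal.ofReal (ρ x)) Kᶜ = 0) (x : E) (hx : x ∉ K) :
    ρ x = 0 := by
  by_contra hne
  have hpos : 0 < ρ x := lt_of_le_of_ne (hρ0 x) (Ne.symm hne)
  have hm : Measurable fun x => ENNReal.ofReal (ρ x) := hρ.measurable.ennreal_ofReal
  rw [withDensity_apply_eq_zero hm] at h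
  have hU : IsOpen ({y | 0 < ρ y} ∩ Kᶜ) := (isOpen_lt continuous_const hρ).inter hK.isOpen_compl
  refine (hU.measure_pos μ ⟨x, hpos, hx⟩).ne' (measure_mono_null ?_ h)
  rintro y ⟨hy, hyK⟩
  exact ⟨by simpa using hy, hyK⟩

theorem ae_map_mem_image_support {Z W : Type*} [TopologicalSpace Z] [HereditarilyLindelofSpace Z]
    [MeasurableSpace Z] [MeasurableSpace W] {ℓ : Measure Z} {f : Z → W}
    (hf : Measurable f) (h : MeasurableSet (f '' ℓ.support)) :
    ∀ᵐ w ∂(ℓ.map f), w ∈ f '' ℓ.support :=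
  (ae_map_iff hf.aemeasurable h).2 <|
    Filter.Eventually.mono Measure.support_mem_ae fun z hz => ⟨z, hz, rfl⟩

theorem map_prodMk_self_real_eq_zero {Z : Type*} [MeasurableSpace Z] (ℓ : Measure Z)
    {s : Set (Z × Z)} (hs : MeasurableSet s) (h : ∀ z, (z, z) ∉ s) :
    (ℓ.map fun z => (z, z)).real s = 0 := by
  have : (fun z => (z, z)) ⁻¹' s = ∅ := by
    ext z; simp [h z]
  rw [measureReal_def, Measure.map_apply (by fun_prop) hs, this]
  simp

theorem map_fst_map_prodMk_self {Z : Type*} [MeasurableSpace Z] (ℓ : Measure Z) :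
    (ℓ.map fun z => (z, z)).map Prod.fst = ℓ := by
  rw [Measure.map_map measurable_fst (by fun_prop)]
  exact Measure.map_id

theorem map_snd_map_prodMk_self {Z : Type*} [MeasurableSpace Z] (ℓ : Measure Z) :
    (ℓ.map fun z => (z, z)).map Prod.snd = ℓ := by
  rw [Measure.map_map measurable_snd (by fun_prop)]
  exact Measure.map_id

theorem isProbabilityMeasure_of_map_fst {Z : Type*} [MeasurableSpace Z] {ℓ : Measure Z}
    [hℓ : IsProbabilityMeasure ℓ] {π : Measure (Z × Z)} (h : π.map Prod.fst = ℓ) :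
    IsProbabilityMeasure π := by
  rw [← h] at hℓ
  exact Measure.isProbabilityMeasure_of_map Prod.fst

section NoiseCoupling

variable {X Z : Type*} [NormedAddCommGroup X] [NormedAddCommGroup Z] [SecondCountableTopology Z]
  [MeasurableSpace Z] [BorelSpace Z]

theorem measurableSet_lt_norm_sub {S : X × Z → X} (hS : Continuous S) (y₁ y₂ : X) (r : ℝ) :
    MeasurableSet {p : Z × Z | r < ‖S (y₁, p.1) - S (y₂, p.2)‖} :=
  (isOpen_lt continuous_const (by fun_prop)).measurableSet

/-- For each pair `y₁, y₂ ∈ Y`, a self-coupling `π` of the noise law with squeezing, with a constant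
uniform in the pair. Nothing is said about how `π` depends on the pair, since no regularity of
`Φ y₁ y₂` in `(y₁, y₂)` is assumed. -/
theorem exists_noise_coupling [NormedSpace ℝ Z] {S : X × Z → X} (hS : Continuous S) (ℓ : Measure Z)
    [IsProbabilityMeasure ℓ] (hE : IsCompact ℓ.support) {q' : ℝ} (Z₁ Z₂ : Submodule ℝ Z)
    [FiniteDimensional ℝ Z₁] (hZ : Z₁.IsTopCompl Z₂) (hC1 : ConditionC1 ℓ Z₁ Z₂ hZ)
    {Y : Set X} {d : ℝ} {Φ : X → X → Z → Z₁} (hC2 : ConditionC2 S ℓ Z₁ Y d q' Φ)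
    (hC3 : ConditionC3 Z₁ Y d Φ) :
    ∃ C : ℝ, 0 < C ∧ ∀ y₁ ∈ Y, ∀ y₂ ∈ Y, ∃ π : Measure (Z × Z),
      π.map Prod.fst = ℓ ∧ π.map Prod.snd = ℓ ∧
      π.real {p | q' * ‖y₁ - y₂‖ < ‖S (y₁, p.1) - S (y₂, p.2)‖} ≤ C * ‖y₁ - y₂‖ := by
  obtain ⟨C₀, hC₀, hΦ⟩ := hC3
  obtain ⟨ρ, hρ, hρ0, hdens⟩ := hC1.density
  have hprod := hC1.product
  set P₁ := Z₁.projectionOntoL Z₂ hZ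
  set P₂ := Z₂.projectionOntoL Z₁ hZ.symm
  have : IsProbabilityMeasure (ℓ.map P₁) :=
    Measure.isProbabilityMeasure_map P₁.continuous.measurable.aemeasurable
  have : IsProbabilityMeasure (ℓ.map P₂) :=
    Measure.isProbabilityMeasure_map P₂.continuous.measurable.aemeasurable
  have hK₁ : IsCompact (P₁ '' ℓ.support) := hE.image P₁.continuous
  have hK₂ : IsCompact (P₂ '' ℓ.support) := hE.image P₂.continuous
  set K₁ := P₁ '' ℓ.support
  set K₂ := P₂ '' ℓ.support
  have hae₁ : ∀ᵐ z ∂(ℓ.map P₁), z ∈ K₁ :=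
    ae_map_mem_image_support P₁.continuous.measurable hK₁.measurableSet
  have hae₂ : ∀ᵐ z ∂(ℓ.map P₂), z ∈ K₂ :=
    ae_map_mem_image_support P₂.continuous.measurable hK₂.measurableSet
  have hρK : ∀ z ∉ K₁, ρ z = 0 := by
    refine eq_zero_of_withDensity_compl_eq_zero (Measure.addHaar : Measure Z₁) hρ.continuous hρ0
      hK₁.isClosed ?_
    rw [← hdens]
    exact hae₁
  obtain ⟨L, hL⟩ := hρ.lipschitzWith_of_hasCompactSupport
    (HasCompactSupport.intro hK₁ hρK) one_ne_zero
  obtain ⟨M₁, hM₁⟩ := hK₁.isBounded.exists_norm_le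
  obtain ⟨M₂, hM₂⟩ := hK₂.isBounded.exists_norm_le
  set M := max M₁ 0 + max M₂ 0
  have hM0 : 0 ≤ M := by positivity
  have hd := hC2.pos
  set n := Module.finrank ℝ Z₁
  set A := n * C₀ + L * (C₀ * M) * (Measure.addHaar : Measure Z₁).real K₁
  have hA : 0 ≤ A := by positivity
  refine ⟨A + C₀ + 1 / d, by positivity, fun y₁ hy₁ y₂ hy₂ => ?_⟩
  set r := ‖y₁ - y₂‖ with hr
  have hr0 : 0 ≤ r := norm_nonneg _
  -- When `‖y₁ - y₂‖` is bounded below, the required bound is at least `1`, so any coupling will do.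
  have trivial_case : 1 ≤ (A + C₀ + 1 / d) * r → ∃ π : Measure (Z × Z),
      π.map Prod.fst = ℓ ∧ π.map Prod.snd = ℓ ∧
      π.real {p | q' * r < ‖S (y₁, p.1) - S (y₂, p.2)‖} ≤ (A + C₀ + 1 / d) * r := fun h =>
    have := isProbabilityMeasure_of_map_fst (map_fst_map_prodMk_self ℓ)
    ⟨_, map_fst_map_prodMk_self ℓ, map_snd_map_prodMk_self ℓ, measureReal_le_one.trans h⟩
  have hd1 : 0 ≤ 1 / d * r := by positivity
  rcases lt_or_ge d r with hdr | hrd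
  · refine trivial_case ?_
    have h1 : 1 ≤ 1 / d * r := by
      rw [one_div, inv_mul_eq_div, one_le_div hd]; exact hdr.le
    nlinarith [mul_nonneg hA hr0, mul_nonneg hC₀.le hr0]
  rcases le_or_gt 1 (C₀ * r) with hη | hη
  · refine trivial_case ?_
    nlinarith [mul_nonneg hA hr0]
  obtain ⟨hbound, hlip⟩ := hΦ y₁ hy₁ y₂ hy₂ hrd
  have hΦc : Continuous (Φ y₁ y₂) := (hC2.contDiff y₁ hy₁ y₂ hy₂ hrd).continuous
  have hsq := hC2.squeezing y₁ hy₁ y₂ hy₂ hrd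
  set e : Z₁ × Z₂ → Z := fun z => (z.1 : Z) + (z.2 : Z)
  have he : Continuous e := by fun_prop
  set φ : Z₁ × Z₂ → Z₁ := fun z => Φ y₁ y₂ (e z) with hφ
  have hφm : Measurable φ := (hΦc.comp he).measurable
  have hprob : IsProbabilityMeasure ((Measure.addHaar : Measure Z₁).withDensity
      fun z => ENNReal.ofReal (ρ z)) := by rw [← hdens]; infer_instance
  -- On `Z₁ × Z₂` the map `ζ ↦ ζ + Φ ζ` is a shear along `Z₁`. The bound on its displacement is only
  -- needed where `ρ ≠ 0` and on the support of the second marginal, where `‖ζ‖ ≤ M`.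
  obtain ⟨a, ha, haΨ, hmass⟩ := exists_le_and_map_shear_le (Measure.addHaar : Measure Z₁)
    (ℓ.map P₂) hL hK₁ hρK hφm (η := C₀ * r) (δ := C₀ * r * M) (by positivity) hη
    (fun t x y => by
      have := hlip (e (x, t)) (e (y, t))
      have h2 : e (x, t) - e (y, t) = ((x - y : Z₁) : Z) := by simp [e]
      rwa [h2, Submodule.coe_norm] at this)
    (by
      filter_upwards [hae₂] with t ht x hx
      refine (hbound _).trans (mul_le_mul_of_nonneg_left ?_ (by positivity))
      refine (norm_add_le _ _).trans (add_le_add ?_ ?_)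
      · exact (hM₁ x hx).trans (le_max_left _ _)
      · exact (hM₂ t ht).trans (le_max_left _ _))
    (by positivity)
  rw [← hdens] at ha haΨ
  obtain ⟨π, hπ₁, hπ₂, hπ⟩ := exists_coupling_of_le_of_map_le _ a (by fun_prop) ha haΨ
  have hee : Measurable (Prod.map e e) := he.measurable.prodMap he.measurable
  refine ⟨π.map (Prod.map e e), ?_, ?_, ?_⟩
  · rw [Measure.map_map measurable_fst hee]
    change π.map (e ∘ Prod.fst) = ℓ
    rw [← Measure.map_map he.measurable measurable_fst, hπ₁, ← hprod]
  · rw [Measure.map_map measurable_snd hee]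
    change π.map (e ∘ Prod.snd) = ℓ
    rw [← Measure.map_map he.measurable measurable_snd, hπ₂, ← hprod]
  · have hs := measurableSet_lt_norm_sub hS y₁ y₂ (q' * r)
    rw [measureReal_def, Measure.map_apply hee hs, ← measureReal_def]
    refine (hπ _ (hee hs) ?_).trans ?_
    · rw [hprod] at hsq
      filter_upwards [ae_of_ae_map he.measurable.aemeasurable hsq] with z hz
      have h2 : e (z.1 + φ z, z.2) = e z + (Φ y₁ y₂ (e z) : Z) := by
        simp only [e, φ, Submodule.coe_add]; abel
      simpa [h2] using hz
    · have : A * r = n * (C₀ * r) + L * (C₀ * r * M) * (Measure.addHaar : Measure Z₁).real K₁ := by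
        simp only [A]; ring
      nlinarith [mul_nonneg hC₀.le hr0]

end NoiseCoupling

/-! ### Measurable dependence on the starting points -/

theorem rdsTransition_one {X Z Ω₀ : Type*} [MeasurableSpace X] [MeasurableSpace Z]
    [MeasurableSpace Ω₀] {S : X × Z → X} (hS : Measurable S) {ξ : ℕ → Ω₀ → Z} {P₀ : Measure Ω₀}
    {ℓ : Measure Z} (hξ : IsIIDWithLaw ξ P₀ ℓ) (x : X) :
    rdsTransition S ξ P₀ 1 x = ℓ.map fun ζ => S (x, ζ) := by
  rw [← hξ.law 0, Measure.map_map (by fun_prop) (hξ.measurable 0)]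
  rfl

section Transfer

variable {X Z : Type*} [NormedAddCommGroup X] [NormedAddCommGroup Z] [SecondCountableTopology Z]
  [MeasurableSpace Z]

/-- A noise coupling that squeezes with rate `q'` at an off-diagonal pair squeezes with any larger
rate `q` at all nearby pairs. -/
theorem eventually_measureReal_lt_norm_sub_le {S : X × Z → X} (hS : Continuous S) (ℓ : Measure Z)
    (hE : IsCompact ℓ.support) {q q' : ℝ} (hqq' : q' < q) {C : ℝ} (hC : 0 < C)
    {y₁ y₂ : X} (hy : y₁ ≠ y₂) {π : Measure (Z × Z)} [IsProbabilityMeasure π]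
    (hπ₁ : π.map Prod.fst = ℓ) (hπ₂ : π.map Prod.snd = ℓ)
    (hπ : π.real {p | q' * ‖y₁ - y₂‖ < ‖S (y₁, p.1) - S (y₂, p.2)‖} ≤ C * ‖y₁ - y₂‖) :
    ∀ᶠ x in 𝓝 (y₁, y₂), π.real {p | q * ‖x.1 - x.2‖ < ‖S (x.1, p.1) - S (x.2, p.2)‖} ≤
      2 * C * ‖x.1 - x.2‖ := by
  set r := ‖y₁ - y₂‖ with hr
  have hr0 : 0 < r := norm_pos_iff.2 (sub_ne_zero.2 hy)
  -- `2 ε` is half of the gap `(q - q') r`; the other half absorbs the change of `‖x.1 - x.2‖`.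
  set ε := (q - q') * r / 4
  have hε : 0 < ε := by
    have : 0 < q - q' := by linarith
    positivity
  have hSunif : ∀ y : X, ∀ᶠ x in 𝓝 y, ∀ ζ ∈ ℓ.support, ‖S (x, ζ) - S (y, ζ)‖ < ε := fun y => by
    obtain ⟨v, hv, hvS⟩ := hE.mem_uniformity_of_prod (f := fun x ζ => S (x, ζ)) (s := Set.univ)
      (q := y) (hf := by exact hS.continuousOn) (Set.mem_univ y) (Metric.dist_mem_uniformity hε)
    rw [nhdsWithin_univ] at hv
    filter_upwards [hv] with x hx ζ hζ
    have := hvS x hx ζ hζ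
    rwa [← dist_eq_norm]
  have hcont : Continuous fun x : X × X => ‖x.1 - x.2‖ := by fun_prop
  have hev₁ : ∀ᶠ x : X × X in 𝓝 (y₁, y₂), (q + q') / 2 * r < q * ‖x.1 - x.2‖ :=
    (continuous_const.mul hcont).continuousAt.eventually_const_lt (by
      change _ < q * r
      nlinarith)
  have hev₂ : ∀ᶠ x : X × X in 𝓝 (y₁, y₂), r / 2 < ‖x.1 - x.2‖ :=
    hcont.continuousAt.eventually_const_lt (by change _ < r; linarith)
  have hsupp₁ : ∀ᵐ p ∂π, p.1 ∈ ℓ.support := by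
    refine ae_of_ae_map measurable_fst.aemeasurable ?_
    rw [hπ₁]; exact Measure.support_mem_ae
  have hsupp₂ : ∀ᵐ p ∂π, p.2 ∈ ℓ.support := by
    refine ae_of_ae_map measurable_snd.aemeasurable ?_
    rw [hπ₂]; exact Measure.support_mem_ae
  filter_upwards [hev₁, hev₂, continuous_fst.continuousAt.eventually (hSunif y₁),
    continuous_snd.continuousAt.eventually (hSunif y₂)] with x h₁ h₂ h₃ h₄
  have hle : π {p | q * ‖x.1 - x.2‖ < ‖S (x.1, p.1) - S (x.2, p.2)‖} ≤
      π {p | q' * r < ‖S (y₁, p.1) - S (y₂, p.2)‖} := by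
    refine measure_mono_ae ?_
    filter_upwards [hsupp₁, hsupp₂] with p hp₁ hp₂ hp
    change q * ‖x.1 - x.2‖ < ‖S (x.1, p.1) - S (x.2, p.2)‖ at hp
    change q' * r < ‖S (y₁, p.1) - S (y₂, p.2)‖
    have h5 : S (x.1, p.1) - S (x.2, p.2) = (S (x.1, p.1) - S (y₁, p.1)) +
        (S (y₁, p.1) - S (y₂, p.2)) - (S (x.2, p.2) - S (y₂, p.2)) := by abel
    have h6 := norm_sub_le ((S (x.1, p.1) - S (y₁, p.1)) + (S (y₁, p.1) - S (y₂, p.2)))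
      (S (x.2, p.2) - S (y₂, p.2))
    have h7 := norm_add_le (S (x.1, p.1) - S (y₁, p.1)) (S (y₁, p.1) - S (y₂, p.2))
    rw [← h5] at h6
    have h8 : ε = (q - q') * r / 4 := rfl
    linarith [h₃ _ hp₁, h₄ _ hp₂]
  have h9 := ENNReal.toReal_mono (measure_ne_top _ _) hle
  refine (h9.trans hπ).trans ?_
  nlinarith

/-- Pairwise noise couplings, with no measurability in the pair, suffice for `CouplingWithRate` at
the expense of an arbitrarily small loss in the rate. -/
theorem couplingWithRate_of_exists_noise_coupling [SecondCountableTopology X]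
    [MeasurableSpace X] [BorelSpace X] [BorelSpace Z] [CompleteSpace Z]
    {S : X × Z → X}
    (hS : Continuous S) (ℓ : Measure Z) [IsProbabilityMeasure ℓ] (hE : IsCompact ℓ.support)
    {q q' : ℝ} (hqq' : q' < q) (Y : Set X) {C : ℝ} (hC : 0 < C)
    (h : ∀ y₁ ∈ Y, ∀ y₂ ∈ Y, ∃ π : Measure (Z × Z),
      π.map Prod.fst = ℓ ∧ π.map Prod.snd = ℓ ∧
      π.real {p | q' * ‖y₁ - y₂‖ < ‖S (y₁, p.1) - S (y₂, p.2)‖} ≤ C * ‖y₁ - y₂‖) :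
    CouplingWithRate (fun y => ℓ.map fun ζ => S (y, ζ)) Y q := by
  have hloc : ∀ x : Y × Y, x.1 ≠ x.2 → ∃ (U : Set (Y × Y)) (π : Measure (Z × Z)),
      IsOpen U ∧ x ∈ U ∧ π.map Prod.fst = ℓ ∧ π.map Prod.snd = ℓ ∧ ∀ y ∈ U,
        π.real {p | q * ‖(y.1 : X) - y.2‖ < ‖S (y.1, p.1) - S (y.2, p.2)‖} ≤
          2 * C * ‖(y.1 : X) - y.2‖ := fun x hx => by
    obtain ⟨π, hπ₁, hπ₂, hπ⟩ := h x.1 x.1.2 x.2 x.2.2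
    have := isProbabilityMeasure_of_map_fst hπ₁
    have hev := eventually_measureReal_lt_norm_sub_le hS ℓ hE hqq' hC
      (Subtype.coe_injective.ne hx) hπ₁ hπ₂ hπ
    have hc : Continuous fun y : Y × Y => ((y.1 : X), (y.2 : X)) := by fun_prop
    obtain ⟨U, hU, hUo, hxU⟩ := eventually_nhds_iff.1 (hc.continuousAt.eventually hev)
    exact ⟨U, π, hUo, hxU, hπ₁, hπ₂, hU⟩
  choose! U π hUo hxU hπ₁ hπ₂ hπ using hloc
  set D : Set (Y × Y) := {x | x.1 = x.2} with hDdef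
  have hD : IsClosed D := isClosed_eq continuous_fst continuous_snd
  obtain ⟨t, htD, ht, hcov⟩ := TopologicalSpace.countable_cover_nhdsWithin (s := Dᶜ) (f := U)
    fun x hx => mem_nhdsWithin_of_mem_nhds ((hUo x hx).mem_nhds (hxU x hx))
  have : Countable t := ht
  -- The diagonal, with both components driven by the same noise, is the extra member of the cover.
  let V : Option t → Set (Y × Y) := fun i => i.elim D fun x => U x
  let ν : Option t → Measure (Z × Z) := fun i => i.elim (ℓ.map fun z => (z, z)) fun x => π x
  have hV : ∀ i, MeasurableSet (V i) := by
    rintro (_ | x)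
    · exact hD.measurableSet
    · exact (hUo x (htD x.2)).measurableSet
  have hVcov : ⋃ i, V i = Set.univ := by
    refine Set.eq_univ_of_forall fun x => ?_
    by_cases hx : x ∈ D
    · exact Set.mem_iUnion.2 ⟨none, hx⟩
    · obtain ⟨y, hy, hxy⟩ := Set.mem_iUnion₂.1 (hcov hx)
      exact Set.mem_iUnion.2 ⟨some ⟨y, hy⟩, hxy⟩
  have hν₁ : ∀ i, (ν i).map Prod.fst = ℓ := by
    rintro (_ | x)
    · exact map_fst_map_prodMk_self ℓ
    · exact hπ₁ x (htD x.2)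
  have hν₂ : ∀ i, (ν i).map Prod.snd = ℓ := by
    rintro (_ | x)
    · exact map_snd_map_prodMk_self ℓ
    · exact hπ₂ x (htD x.2)
  have hνprob : ∀ i, IsProbabilityMeasure (ν i) := fun i => isProbabilityMeasure_of_map_fst (hν₁ i)
  have hν : ∀ i, ∀ y ∈ V i,
      (ν i).real {p | q * ‖(y.1 : X) - y.2‖ < ‖S (y.1, p.1) - S (y.2, p.2)‖} ≤
        2 * C * ‖(y.1 : X) - y.2‖ := by
    rintro (_ | x) y hy
    · refine (map_prodMk_self_real_eq_zero ℓ (measurableSet_lt_norm_sub hS _ _ _) fun z => ?_).trans_le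
        (by positivity)
      have hy' : y.1 = y.2 := hy
      simp [hy']
    · exact hπ x (htD x.2) y hy
  obtain ⟨F, hF, hFν⟩ := exists_unitInterval_map_eq_of_iUnion_eq_univ hV hVcov ν
  have hG : Measurable fun x : Y × Y × unitInterval => F ((x.1, x.2.1), x.2.2) := by fun_prop
  refine ⟨2 * C, by positivity, unitInterval, inferInstance, volume,
    fun x => S (x.1, (F ((x.1, x.2.1), x.2.2)).1),
    fun x => S (x.2.1, (F ((x.1, x.2.1), x.2.2)).2), inferInstance, ?_, ?_, fun y₁ y₂ => ?_⟩
  · exact hS.measurable.comp (measurable_fst.subtype_val.prodMk hG.fst)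
  · exact hS.measurable.comp (measurable_snd.fst.subtype_val.prodMk hG.snd)
  · obtain ⟨i, hi, hmap⟩ := hFν (y₁, y₂)
    have hFm : Measurable fun ω => F ((y₁, y₂), ω) := by fun_prop
    have hm : ∀ y : X, Measurable fun ζ => S (y, ζ) := fun y => by fun_prop
    refine ⟨⟨(hm y₁).comp hFm.fst, (hm y₂).comp hFm.snd, ?_, ?_⟩, ?_⟩
    · beta_reduce
      rw [← hν₁ i, ← hmap, Measure.map_map measurable_fst hFm,
        Measure.map_map (hm y₁) (measurable_fst.comp hFm)]
      rfl
    · beta_reduce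
      rw [← hν₂ i, ← hmap, Measure.map_map measurable_snd hFm,
        Measure.map_map (hm y₂) (measurable_snd.comp hFm)]
      rfl
    · have h1 := hν i _ hi
      rw [← hmap, measureReal_def,
        Measure.map_apply hFm (measurableSet_lt_norm_sub hS _ _ _), ← measureReal_def] at h1
      exact h1

end Transfer

theorem lemma5p3
    {X Z Ω₀ : Type*}
    [NormedAddCommGroup X] [NormedSpace ℝ X] [CompleteSpace X]
    [TopologicalSpace.SeparableSpace X] [MeasurableSpace X] [BorelSpace X]
    [NormedAddCommGroup Z] [NormedSpace ℝ Z] [CompleteSpace Z]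
    [TopologicalSpace.SeparableSpace Z] [MeasurableSpace Z] [BorelSpace Z]
    (S : X × Z → X) (hS : LocallyLipschitz S)
    -- the noise: i.i.d. random variables whose common law has compact support
    [MeasurableSpace Ω₀] (P₀ : Measure Ω₀) [IsProbabilityMeasure P₀]
    (ξ : ℕ → Ω₀ → Z) (ℓ : Measure Z) (hξ : IsIIDWithLaw ξ P₀ ℓ)
    (hE : IsCompact ℓ.support)
    (q q' : ℝ) (hq' : 0 < q') (hqq' : q' < q) (hq : q < 1)
    -- (C1)
    (Z₁ Z₂ : Submodule ℝ Z) [FiniteDimensional ℝ Z₁] (hZ : Z₁.IsTopCompl Z₂)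
    (hC1 : ConditionC1 ℓ Z₁ Z₂ hZ)
    -- (C2) and (C3)
    (Y : Set X) (d : ℝ) (Φ : X → X → Z → Z₁)
    (hC2 : ConditionC2 S ℓ Z₁ Y d q' Φ)
    (hC3 : ConditionC3 Z₁ Y d Φ) :
    HypothesisC (rdsTransition S ξ P₀ 1) Y ∧
      CouplingWithRate (rdsTransition S ξ P₀ 1) Y q := by
  have := UniformSpace.secondCountable_of_separable X
  have := UniformSpace.secondCountable_of_separable Z
  have : IsProbabilityMeasure ℓ := by
    rw [← hξ.law 0]
    exact Measure.isProbabilityMeasure_map (hξ.measurable 0).aemeasurable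
  obtain ⟨C, hC, h⟩ := exists_noise_coupling hS.continuous ℓ hE Z₁ Z₂ hZ hC1 hC2 hC3
  have key : CouplingWithRate (rdsTransition S ξ P₀ 1) Y q := by
    have hQ : rdsTransition S ξ P₀ 1 = fun y => ℓ.map fun ζ => S (y, ζ) :=
      funext (rdsTransition_one hS.continuous.measurable hξ)
    rw [hQ]
    exact couplingWithRate_of_exists_noise_coupling hS.continuous ℓ hE hqq' Y hC h
  exact ⟨⟨q, by linarith, hq, key⟩, key⟩
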